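/- Conventions. A monoid is a commutative cancellative semigroup with identity; an atom of a monoid or domain is a (nonzero) non-unit that is not a product of two non-units. A monoid is a Krull monoid if it is completely integrally closed and satisfies the ascending chain condition on $v$-ideals. A monoid homomorphism $\theta\colon S\to B$ is a transfer homomorphism if $B=\theta(S)B^\times$, $\theta^{-1}(B^\times)=S^\times$, and whenever $\theta(s)=bc$ with $s\in S$, $b,c\in B$, there are $x,y\in S$ with $s=xy$, $\theta(x)\in bB^\times$ and $\theta(y)\in cB^\times$. A domain $A$ is transfer Krull if its monoid $A\setminus\{0\}$ admits a transfer homomorphism to a Krull monoid. Proposition 4.2. Let $R$ be a Dedekind domain whose class group $\mathrm{Cl}(R)$ is a torsion group. Let $\mathcal O\subseteq R$ be an order, that is, a subring with the same quotient field as $R$ such that $R$ is a finitely generated $\mathcal O$-module, and let $\mathfrak f=\{x\in R : xR\subseteq\mathcal O\}$ be its conductor. Suppose that $R/\mathfrak f$ is finite and that every class of $\mathrm{Cl}(R)$ contains a nonzero prime ideal coprime to $\mathfrak f$. Suppose moreover that $\mathcal O$ is transfer Krull and that $\mathrm{Pic}(\mathcal O)\cong\mathrm{Cl}(R)$ via the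 natural homomorphism $[I]\mapsto[IR]$. Let $P$ be a nonzero prime ideal of $R$ dividing $\mathfrak f$, let $\mathfrak p=P\cap\mathcal O$, and let $n=\mathrm{ord}([P])$ be the order of the class of $P$ in $\mathrm{Cl}(R)$. Then $P$ is the only nonzero prime ideal of $R$ lying over $\mathfrak p$, so that the $P$-adic valuation restricts to a well-defined valuation $\mathsf v_{\mathfrak p}$ on the localization $\mathcal O_{\mathfrak p}$. Writing $\mathcal A(\mathcal O_{\mathfrak p})$ for the set of atoms of $\mathcal O_{\mathfrak p}$, we have $$\mathsf v_{\mathfrak p}(\mathcal A(\mathcal O_{\mathfrak p}))\subseteq\{1,2\}\ \text{ if } n=2,\qquad \mathsf v_{\mathfrak p}(\mathcal A(\mathcal O_{\mathfrak p}))=\{1\}\ \text{ if } n\neq 2.$$ Moreover, $\mathcal O\cdot R^\times=R$, that is, every element of $R$ is the product of an element of $\mathcal O$ and a unit of $R$. -/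

import Mathlib

open scoped nonZeroDivisors
open IsDedekindDomain

universe u v

/-! ### Krull monoids and transfer homomorphisms

Monoids are commutative and cancellative, written multiplicatively; the quotient group of `B` is
`Algebra.GrothendieckGroup B`. -/

namespace TransferKrull

section Monoids

variable (B : Type v) [CancelCommMonoid B]

/-- The image of `B` in its quotient group. -/
def image : Set (Algebra.GrothendieckGroup B) :=
  Set.range (Algebra.GrothendieckGroup.of (M := B))

/-- `B` equals its complete integral closure: if `x` is in the quotient group and there is `c ∈ B`
with `c * x ^ n ∈ B` for all positive integers `n`, then `x ∈ B`. -/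
def IsCompletelyIntegrallyClosed : Prop :=
  ∀ x : Algebra.GrothendieckGroup B,
    (∃ c : B, ∀ n : ℕ, 0 < n → Algebra.GrothendieckGroup.of c * x ^ n ∈ image B) → x ∈ image B

variable {B} in
/-- `(B : X) = {z ∈ q(B) | z X ⊆ B}`. -/
def colon (X : Set (Algebra.GrothendieckGroup B)) : Set (Algebra.GrothendieckGroup B) :=
  {z | ∀ x ∈ X, z * x ∈ image B}

variable {B} in
/-- `I ⊆ B` is a `v`-ideal (divisorial ideal) if `I = (B : (B : I))`. -/
def IsVIdeal (I : Set (Algebra.GrothendieckGroup B)) : Prop :=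
  I ⊆ image B ∧ colon (colon I) = I

/-- A Krull monoid is completely integrally closed and satisfies the ascending chain condition on
`v`-ideals. -/
structure IsKrullMonoid : Prop where
  completelyIntegrallyClosed : IsCompletelyIntegrallyClosed B
  acc_vIdeals : ∀ I : ℕ → Set (Algebra.GrothendieckGroup B),
    (∀ n, IsVIdeal (I n)) → Monotone I → ∃ N, ∀ n, N ≤ n → I n = I N

end Monoids

/-- Transfer homomorphisms of monoids. -/
structure IsTransferHom {S : Type u} {B : Type v} [CommMonoid S] [CommMonoid B] (θ : S →* B) :
    Prop where
  /-- `B = θ(S) * Bˣ` -/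
  exists_eq_mul_unit : ∀ b : B, ∃ s : S, ∃ ε : Bˣ, b = θ s * ε
  /-- `θ⁻¹(Bˣ) = Sˣ` -/
  isUnit_iff : ∀ s : S, IsUnit (θ s) ↔ IsUnit s
  /-- the transfer property -/
  exists_factorization : ∀ (s : S) (b c : B), θ s = b * c →
    ∃ x y : S, s = x * y ∧ Associated (θ x) b ∧ Associated (θ y) c

/-- `S` is transfer Krull: it admits a transfer homomorphism to a Krull monoid. -/
def IsTransferKrullMonoid (S : Type u) [CommMonoid S] : Prop :=
  ∃ (B : Type v) (_ : CancelCommMonoid B) (θ : S →* B), IsKrullMonoid B ∧ IsTransferHom θ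

/-- A domain is transfer Krull if its multiplicative monoid of nonzero elements is. -/
def IsTransferKrullDomain (A : Type u) [CommRing A] [IsDomain A] : Prop :=
  IsTransferKrullMonoid.{u, v} A⁰

/-! ### Orders in Dedekind domains -/

section Orders

variable {R : Type u} [CommRing R] [IsDedekindDomain R]

/-- A subring `O` of `R` is an order in `R` if it has the same quotient field as `R` and `R` is a
finitely generated `O`-module. -/
structure IsOrderIn (O : Subring R) : Prop where
  isFractionRing : IsFractionRing O (FractionRing R)
  finite : Module.Finite O R


/-- The conductor `{x ∈ R | x R ⊆ O}`, the greatest ideal of `R` contained in `O`. -/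
def orderConductor (O : Subring R) : Ideal R where
  carrier := {x | ∀ y : R, x * y ∈ O}
  zero_mem' y := by simp
  add_mem' ha hb y := by simpa only [add_mul] using O.add_mem (ha y) (hb y)
  smul_mem' c a ha y := by simpa only [smul_eq_mul, mul_left_comm, mul_assoc] using ha (c * y)

/-- The ideal class `[P]` of a nonzero prime ideal. -/
noncomputable def primeClass (P : HeightOneSpectrum R) : ClassGroup R :=
  ClassGroup.mk0 ⟨P.asIdeal, mem_nonZeroDivisors_of_ne_zero P.ne_bot⟩

/-- The localization `O_𝔭` at `𝔭 = P ∩ O`. -/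
abbrev LocalOrder (O : Subring R) (P : HeightOneSpectrum R) : Type u :=
  Localization.AtPrime (P.asIdeal.under O)

/-- The `P`-adic valuation on `O_𝔭`, where `𝔭 = P ∩ O`: the highest power of the maximal ideal of
the discrete valuation ring `R_P` that divides the image of `x` under `O_𝔭 ⊆ R_P`. If `P` is the
only prime ideal of `R` over `𝔭`, then `R_P` is the integral closure of `O_𝔭`, and this is the
valuation `v_𝔭`. -/
noncomputable def localValuation (O : Subring R) (P : HeightOneSpectrum R) (x : LocalOrder O P) :
    ℕ∞ :=
  emultiplicity (IsLocalRing.maximalIdeal (Localization.AtPrime P.asIdeal))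
    (Ideal.span {Localization.localRingHom (P.asIdeal.under O) P.asIdeal (algebraMap O R) rfl x})

/-- `v_𝔭(𝒜(O_𝔭))`: the set of valuations of the atoms of `O_𝔭`. -/
def atomValuations (O : Subring R) (P : HeightOneSpectrum R) : Set ℕ∞ :=
  localValuation O P '' {x | Irreducible x}

end Orders

end TransferKrull

/-! Let `𝔣` be the conductor of the order `O` in `R`, and let `θ` be a transfer homomorphism from the
nonzero elements of `O` to a Krull monoid `B`. Of `B` only complete integral closedness is used. If
`c ∈ 𝔣` is nonzero, then `c r ^ n ∈ O` for all `r ∈ R` and all `n`, so `θ` extends to a homomorphism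
`Θ` from the nonzero elements of `R` to `B` (`exists_extension`). Elements of `R` outside `O` thus
provide factorizations in `B`, which the transfer property lifts to factorizations in `O`.

*Uniqueness of `P` over `𝔭`.* Suppose `P ≠ Q` lie over the same prime of `O`, and let `πR` be a
power of `P`. If `Θ π` were not a unit, then for nonzero `h ∈ 𝔣` the element `h π ^ N` would split in
`O` into at least `N` nonunits, each of them divisible by a prime other than `P`, which is absurd for
large `N`. So `Θ` is a unit on every element all of whose prime divisors share their prime of `O`
with another prime of `R`; but `O` contains nonunits of that kind (`IsTransferOn.eq_of_under_eq`).

*Valuations of atoms.* As `Pic(O) → Cl(R)` is injective, every element of `R` coprime to `𝔣` is a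
unit of `R` times an element of `O` (`exists_unit_mul_of_isCoprime`). Let `x` be an atom of `O_𝔭`
with `v(x) = k`, let `n` be the order of `[P]`, and let `Q` be a prime in the class `[P]⁻¹`, coprime
to `𝔣`, with `PQ = tR`. Some `α ∈ O` is associated to `x` in `O_𝔭` and satisfies `αR = (PQ) ^ k`, so
`Θ α` is associated to `Θ t ^ k`, and `α` is a product of `k` nonunits of `O`. As `x` is an atom, all
but one of them lie outside `P`; their ideals are principal powers of `Q`, with exponents at least
`n`. Hence `(k - 1) n ≤ k`, and `k ≥ 2`, `n ≥ 2` force `k = n = 2`. For `n = 1` the unit ideal takes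
the place of `Q` (`IsLocalAtom.val_eq`).

*The equality `O · Rˣ = R`.* By the bound on atoms, `O` contains elements of `P`-valuation `1`
(`exists_val_eq_one`), and these can be chosen outside the other primes containing `𝔣`
(`exists_local_associate`). Hence every `r ∈ R` has the same valuations at the primes dividing `𝔣` as
some `a ∈ O`, and then `r` is associated to an element of `O` (`exists_unit_mul_mem`). -/

namespace TransferKrull

/-! ### Extending a transfer homomorphism to the maximal order -/

section Extension

variable {R : Type u} [CommRing R]

/-- A homomorphism on the nonzero elements of `R` whose restriction to the nonzero elements of `O`
reflects units and lifts factorizations. Being a unit is meant in `R`: an order contains the inverses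
of those of its elements that are units of `R`. -/
structure IsTransferOn (O : Subring R) {B : Type v} [CommMonoid B] (Θ : R⁰ →* B) : Prop where
  isUnit_of_isUnit : ∀ r : R⁰, (r : R) ∈ O → IsUnit (Θ r) → IsUnit (r : R)
  exists_factorization : ∀ (r : R⁰) (b c : B), (r : R) ∈ O → Associated (Θ r) (b * c) →
    ∃ x y : R⁰, (x : R) ∈ O ∧ (y : R) ∈ O ∧ r = x * y ∧ Associated (Θ x) b ∧ Associated (Θ y) c

/-- Lifting a factorization of `Θ r` as a power: `r` splits accordingly. -/
theorem IsTransferOn.exists_multiset {O : Subring R} {B : Type v} [CancelCommMonoid B]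
    {Θ : R⁰ →* B} (hΘ : IsTransferOn O Θ) {b : B} (k : ℕ) {r : R⁰} (hr : (r : R) ∈ O)
    (h : Associated (Θ r) (b ^ (k + 1))) :
    ∃ s : Multiset R⁰, s.card = k + 1 ∧ s.prod = r ∧ ∀ x ∈ s, (x : R) ∈ O ∧
      Associated (Θ x) b := by
  induction k generalizing r with
  | zero => exact ⟨{r}, by simp, by simp, by simpa using ⟨hr, by simpa using h⟩⟩
  | succ k ih =>
    rw [pow_succ'] at h
    obtain ⟨x, y, hx, hy, rfl, hxb, hyb⟩ := hΘ.exists_factorization r _ _ hr h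
    obtain ⟨s, hs, rfl, h'⟩ := ih hy hyb
    refine ⟨x ::ₘ s, by simp [hs], by simp, fun z hz ↦ ?_⟩
    rcases Multiset.mem_cons.1 hz with rfl | hz
    · exact ⟨hx, hxb⟩
    · exact h' z hz

variable [IsDedekindDomain R]

/-- Every element `r` of `R` is almost integral over `O`, because `c * r ^ n ∈ O` for all `n` when
`c` lies in the conductor. Hence a homomorphism from `O` to a completely integrally closed monoid
extends to `R`. -/
theorem exists_extension {O : Subring R} {B : Type v} [CancelCommMonoid B]
    (hB : IsCompletelyIntegrallyClosed B) (θ : O⁰ →* B) {c : R} (hc : c ∈ orderConductor O)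
    (hc0 : c ≠ 0) :
    ∃ Θ : R⁰ →* B, ∀ (a : O⁰) (r : R⁰), (r : R) = ((a : O) : R) → Θ r = θ a := by
  let m : R⁰ → O⁰ := fun r ↦ ⟨⟨c * r, hc r⟩, mem_nonZeroDivisors_of_ne_zero (by
    intro h
    have h' : c * (r : R) = 0 := congrArg Subtype.val h
    exact mul_ne_zero hc0 (nonZeroDivisors.ne_zero r.2) h')⟩
  have hm : ∀ r s t w : R⁰, r * s = t * w → θ (m r) * θ (m s) = θ (m t) * θ (m w) := by
    intro r s t w h
    rw [← map_mul, ← map_mul]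
    congr 1
    apply Subtype.ext; apply Subtype.ext
    have h' : (r : R) * s = t * w := congrArg Subtype.val h
    change c * (r : R) * (c * s) = c * t * (c * w)
    linear_combination c * c * h'
  have key : ∀ r : R⁰, ∃ b : B, b * θ (m 1) = θ (m r) := by
    intro r
    let g := Algebra.GrothendieckGroup.of (M := B)
    have hpow : ∀ n : ℕ, g (θ (m (r ^ n))) = g (θ (m 1)) * (g (θ (m r)) * (g (θ (m 1)))⁻¹) ^ n := by
      intro n
      induction n with
      | zero => simp
      | succ n ih =>
        rw [pow_succ, pow_succ, ← mul_assoc, ← ih, ← mul_assoc, eq_mul_inv_iff_mul_eq, ← map_mul g,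
          ← map_mul g, hm (r ^ n * r) 1 (r ^ n) r (mul_one _)]
    obtain ⟨b, hb⟩ := hB (g (θ (m r)) * (g (θ (m 1)))⁻¹)
      ⟨θ (m 1), fun n _ ↦ ⟨θ (m (r ^ n)), hpow n⟩⟩
    refine ⟨b, Algebra.GrothendieckGroup.of_injective ?_⟩
    rw [eq_mul_inv_iff_mul_eq, ← map_mul] at hb
    exact hb
  choose Θ hΘ using key
  have hone : Θ 1 = 1 := by
    have h := hΘ 1
    rwa [mul_eq_right] at h
  have hmul : ∀ r s, Θ (r * s) = Θ r * Θ s := by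
    intro r s
    have h := hm (r * s) 1 r s (mul_one _)
    rw [← hΘ (r * s), ← hΘ r, ← hΘ s] at h
    exact mul_right_cancel (b := θ (m 1)) (mul_right_cancel (b := θ (m 1))
      (by rw [h]; exact mul_mul_mul_comm _ _ _ _ |>.trans (mul_assoc _ _ _).symm))
  refine ⟨⟨⟨Θ, hone⟩, hmul⟩, fun a r har ↦ mul_right_cancel (b := θ (m 1)) ((hΘ r).trans ?_)⟩
  rw [← map_mul]
  congr 1
  apply Subtype.ext; apply Subtype.ext
  change c * (r : R) = (a : O) * (c * 1)
  rw [har]; ring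

theorem exists_isTransferOn {O : Subring R} (hO : IsTransferKrullDomain.{u, v} O) {c : R}
    (hc : c ∈ orderConductor O) (hc0 : c ≠ 0) :
    ∃ (B : Type v) (_ : CancelCommMonoid B) (Θ : R⁰ →* B), IsTransferOn O Θ := by
  obtain ⟨B, _, θ, hB, hθ⟩ := hO
  obtain ⟨Θ, hΘ⟩ := exists_extension hB.completelyIntegrallyClosed θ hc hc0
  have lift : ∀ r : R⁰, (r : R) ∈ O → ∃ a : O⁰, (r : R) = ((a : O) : R) := fun r hr ↦
    ⟨⟨⟨r, hr⟩, mem_nonZeroDivisors_of_ne_zero fun h ↦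
      nonZeroDivisors.ne_zero r.2 (congrArg Subtype.val h)⟩, rfl⟩
  refine ⟨B, _, Θ, ⟨fun r hr hu ↦ ?_, fun r b c hr h ↦ ?_⟩⟩
  · obtain ⟨a, ha⟩ := lift r hr
    rw [hΘ a r ha, hθ.isUnit_iff] at hu
    rw [ha]
    exact (hu.map (O⁰).subtype).map O.subtype
  · obtain ⟨a, ha⟩ := lift r hr
    rw [hΘ a r ha] at h
    obtain ⟨u, hu⟩ := h.symm
    obtain ⟨x, y, hxy, hx, hy⟩ := hθ.exists_factorization a b (c * u) (by rw [← hu, mul_assoc])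
    have down : ∀ z : O⁰, ((z : O) : R) ≠ 0 := fun z h ↦
      nonZeroDivisors.ne_zero z.2 (Subtype.ext h)
    refine ⟨⟨_, mem_nonZeroDivisors_of_ne_zero (down x)⟩,
      ⟨_, mem_nonZeroDivisors_of_ne_zero (down y)⟩, x.1.2, y.1.2, ?_, ?_, ?_⟩
    · apply Subtype.ext
      rw [ha, hxy]; rfl
    · rwa [hΘ x _ rfl]
    · rw [hΘ y _ rfl]
      exact hy.trans (associated_mul_unit_left c u u.isUnit)

end Extension

/-! ### The conductor -/

section Conductor

variable {R : Type u} [CommRing R] {O : Subring R}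

theorem mem_of_mem_orderConductor {x : R} (hx : x ∈ orderConductor O) : x ∈ O := by
  simpa using hx 1

theorem exists_pow_sub_one_mem (hfin : Finite (R ⧸ orderConductor O)) {r : R}
    (hr : IsCoprime (Ideal.span {r}) (orderConductor O)) :
    ∃ k : ℕ, 0 < k ∧ r ^ k - 1 ∈ orderConductor O := by
  obtain ⟨x, hx, y, hy, hxy⟩ := Submodule.mem_sup.1
    ((Ideal.eq_top_iff_one _).1 (Ideal.isCoprime_iff_sup_eq.1 hr))
  obtain ⟨z, rfl⟩ := Ideal.mem_span_singleton.1 hx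
  have hu : IsUnit (Ideal.Quotient.mk (orderConductor O) r) := by
    refine IsUnit.of_mul_eq_one (Ideal.Quotient.mk _ z) ?_
    rw [← map_mul, ← map_one (Ideal.Quotient.mk _), Ideal.Quotient.eq, ← hxy]
    simpa using hy
  obtain ⟨w, hw⟩ := hu
  obtain ⟨k, hk, hk'⟩ := (isOfFinOrder_of_finite w).exists_pow_eq_one
  refine ⟨k, hk, ?_⟩
  rw [← Ideal.Quotient.eq, map_pow, map_one, ← hw, ← Units.val_pow_eq_pow_val, hk', Units.val_one]

/-- Elements of `O` coprime to the conductor are invertible modulo the conductor, so they may be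
cancelled in a membership in `O`. -/
theorem mem_of_mul_mem (hfin : Finite (R ⧸ orderConductor O)) {x b : R} (hb : b ∈ O)
    (hbf : IsCoprime (Ideal.span {b}) (orderConductor O)) (h : x * b ∈ O) : x ∈ O := by
  obtain ⟨k, hk, hk'⟩ := exists_pow_sub_one_mem hfin hbf
  obtain ⟨k, rfl⟩ := Nat.exists_eq_add_of_lt hk
  have h1 : x * b ^ (0 + k + 1) ∈ O := by
    rw [pow_succ', ← mul_assoc]; exact O.mul_mem h (O.pow_mem hb _)
  have h2 := hk' x
  have : x = x * b ^ (0 + k + 1) - (b ^ (0 + k + 1) - 1) * x := by ring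
  rw [this]; exact O.sub_mem h1 h2

variable [IsDedekindDomain R]

theorem orderConductor_ne_bot (hO : IsOrderIn O) : orderConductor O ≠ ⊥ := by
  classical
  have := hO.isFractionRing
  obtain ⟨t, ht⟩ := hO.finite.fg_top
  obtain ⟨b, hb⟩ := IsLocalization.exist_integer_multiples_of_finset (O⁰)
    (t.image (algebraMap R (FractionRing R)))
  have hmem : ∀ y : R, ((b : O) : R) * y ∈ O := by
    intro y
    have hy : y ∈ Submodule.span O (t : Set R) := by rw [ht]; trivial
    induction hy using Submodule.span_induction with
    | mem x hx =>
      obtain ⟨a, ha⟩ := hb _ (Finset.mem_image_of_mem _ hx)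
      have : ((a : O) : R) = (b : O) * x := by
        apply IsFractionRing.injective R (FractionRing R)
        rw [map_mul]
        rwa [Algebra.smul_def, IsScalarTower.algebraMap_apply O R (FractionRing R),
          IsScalarTower.algebraMap_apply O R (FractionRing R)] at ha
      rw [← this]; exact a.2
    | zero => simp
    | add x y _ _ hx hy => rw [mul_add]; exact O.add_mem hx hy
    | smul a x _ hx =>
      rw [Subring.smul_def, smul_eq_mul, mul_left_comm]
      exact O.mul_mem a.2 hx
  intro h
  have h0 : ((b : O) : R) ∈ orderConductor O := hmem
  rw [h, Ideal.mem_bot] at h0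
  exact nonZeroDivisors.ne_zero b.2 (Subtype.ext h0)

theorem isCoprime_orderConductor_iff (hf : orderConductor O ≠ ⊥) {I : Ideal R} :
    IsCoprime I (orderConductor O) ↔
      ∀ P : HeightOneSpectrum R, P.asIdeal ∣ orderConductor O → ¬ I ≤ P.asIdeal := by
  rw [Ideal.isCoprime_iff_sup_eq]
  constructor
  · intro h P hP hI
    have := sup_le hI (Ideal.le_of_dvd hP)
    rw [h] at this
    exact P.isPrime.ne_top (top_le_iff.1 this)
  · intro h
    by_contra hne
    obtain ⟨M, hM, hle⟩ := Ideal.exists_le_maximal _ hne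
    refine h ⟨M, hM.isPrime, ?_⟩ (Ideal.dvd_iff_le.2 (le_sup_right.trans hle))
      (le_sup_left.trans hle)
    rintro rfl
    exact hf (le_bot_iff.1 (le_sup_right.trans hle))

theorem exists_pow_eq_span (hTorsion : ∀ g : ClassGroup R, IsOfFinOrder g) {I : Ideal R}
    (hI : I ≠ ⊥) : ∃ (m : ℕ) (α : R), 0 < m ∧ α ≠ 0 ∧ I ^ m = Ideal.span {α} := by
  have hI' : I ∈ (Ideal R)⁰ := mem_nonZeroDivisors_of_ne_zero hI
  obtain ⟨m, hm, h⟩ := (hTorsion (ClassGroup.mk0 ⟨I, hI'⟩)).exists_pow_eq_one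
  rw [← map_pow] at h
  obtain ⟨α, hα⟩ := ((ClassGroup.mk0_eq_one_iff (pow_mem hI' m)).1 h).principal
  refine ⟨m, α, hm, ?_, hα⟩
  rintro rfl
  rw [Submodule.span_zero_singleton] at hα
  exact pow_ne_zero m hI hα

/-! ### Consequences of `Pic(O) ≅ Cl(R)` -/

/-- An element of `R` coprime to the conductor generates the same ideal of `R` as some element of
`O`: the ideal `rR ∩ O` of `O` is invertible, with inverse `r⁻ᵏ(rᵏ⁻¹R ∩ O)` when `rᵏ ≡ 1` modulo the
conductor, and its extension to `R` is principal. -/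
theorem exists_unit_mul_of_isCoprime (hfin : Finite (R ⧸ orderConductor O))
    (hPic : Function.Injective (ClassGroup.extendedHom O R)) {r : R} (hr0 : r ≠ 0)
    (hr : IsCoprime (Ideal.span {r}) (orderConductor O)) :
    ∃ (b : R) (ε : Rˣ), b ∈ O ∧ r = ε * b := by
  obtain ⟨k, hk, hkf⟩ := exists_pow_sub_one_mem hfin hr
  obtain ⟨j, rfl⟩ : ∃ j, k = j + 1 := ⟨k - 1, by omega⟩
  have hkO : r ^ (j + 1) ∈ O := by
    simpa using O.add_mem (mem_of_mem_orderConductor hkf) O.one_mem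
  let ρ : O := ⟨r ^ (j + 1), hkO⟩
  have hρ0 : ρ ≠ 0 := fun h ↦ pow_ne_zero (j + 1) hr0 (congrArg Subtype.val h)
  let I : Ideal O := (Ideal.span {r}).comap (algebraMap O R)
  let J : Ideal O := (Ideal.span {r ^ j}).comap (algebraMap O R)
  have hI : ∀ a : O, a ∈ I ↔ r ∣ a := fun a ↦ Ideal.mem_span_singleton
  have hJ : ∀ a : O, a ∈ J ↔ r ^ j ∣ a := fun a ↦ Ideal.mem_span_singleton
  let c : O := ρ - 1
  have hc : (c : R) ∈ orderConductor O := hkf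
  have hρI : ρ ∈ I := (hI _).2 (dvd_pow_self r j.succ_ne_zero)
  let rc : O := ⟨r * c, by rw [mul_comm]; exact hc r⟩
  let rjc : O := ⟨r ^ j * c, by rw [mul_comm]; exact hc _⟩
  have hrc : rc ∈ I := (hI _).2 (dvd_mul_right _ _)
  have hIJ : I * J = Ideal.span {ρ} := by
    apply le_antisymm
    · rw [Ideal.mul_le]
      intro a ha b hb
      obtain ⟨x, hx⟩ := (hI a).1 ha
      obtain ⟨y, hy⟩ := (hJ b).1 hb
      have hab : ((a * b : O) : R) = x * y * r ^ (j + 1) := by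
        rw [Subring.coe_mul, hx, hy]; ring
      have hxy : x * y ∈ O := by
        refine mem_of_mul_mem hfin hkO ?_ (hab ▸ (a * b).2)
        rw [← Ideal.span_singleton_pow]
        exact hr.pow_left
      exact Ideal.mem_span_singleton'.2 ⟨⟨x * y, hxy⟩, Subtype.ext hab.symm⟩
    · rw [Ideal.span_singleton_le_iff_mem]
      -- Both `ρ * ρ ^ j` and `ρ * c ^ 2` lie in `I * J`, and `ρ ^ j ≡ 1` modulo `c`.
      have h1 : ρ * ρ ^ j ∈ I * J := by
        refine Ideal.mul_mem_mul hρI ((hJ _).2 ?_)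
        exact pow_dvd_pow_of_dvd (dvd_pow_self r j.succ_ne_zero) j
      have h2 : rc * rjc ∈ I * J :=
        Ideal.mul_mem_mul hrc ((hJ _).2 (dvd_mul_right _ _))
      have h2' : rc * rjc = ρ * c ^ 2 := by
        apply Subtype.ext
        change r * (c : R) * (r ^ j * c) = r ^ (j + 1) * (c : R) ^ 2
        ring
      obtain ⟨z, hz⟩ : c ∣ ρ ^ j - 1 := by simpa using sub_dvd_pow_sub_pow ρ 1 j
      have : ρ = (1 - c * z) * (ρ * ρ ^ j) + z ^ 2 * (rc * rjc) := by
        rw [h2']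
        linear_combination (-(1 - c * z) * ρ) * hz
      rw [this]
      exact add_mem (Ideal.mul_mem_left _ _ h1) (Ideal.mul_mem_left _ _ h2)
  have hmap : I.map (algebraMap O R) = Ideal.span {r} := by
    refine le_antisymm Ideal.map_comap_le ?_
    rw [Ideal.span_singleton_le_iff_mem]
    have h := sub_mem (Ideal.mul_mem_left _ r (Ideal.mem_map_of_mem (algebraMap O R) hρI))
      (Ideal.mem_map_of_mem (algebraMap O R) hrc)
    have hr' : r * algebraMap O R ρ - algebraMap O R rc = r := by
      change r * (ρ : R) - r * ((ρ : R) - 1) = r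
      ring
    rwa [hr'] at h
  let K := FractionRing O
  have hunit : ∃ U : (FractionalIdeal O⁰ K)ˣ, (U : FractionalIdeal O⁰ K) = I := by
    have h : IsUnit ((I : FractionalIdeal O⁰ K) * (J : FractionalIdeal O⁰ K)) := by
      rw [← FractionalIdeal.coeIdeal_mul, hIJ, FractionalIdeal.coeIdeal_span_singleton,
        ← Units.val_mk0 (a := algebraMap O K ρ)
          ((map_ne_zero_iff _ (IsFractionRing.injective O K)).2 hρ0),
        ← coe_toPrincipalIdeal]
      exact Units.isUnit _
    exact isUnit_of_mul_isUnit_left h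
  obtain ⟨U, hU⟩ := hunit
  have h1 : ClassGroup.mk K U = 1 := by
    apply hPic
    rw [map_one, ClassGroup.extendedHom_mk,
      ClassGroup.mk_eq_one_of_coe_ideal (I' := Ideal.span {r})]
    · exact ⟨r, hr0, rfl⟩
    · rw [← hmap, ← FractionalIdeal.extendedHom_coeIdeal_eq_map (K := K), ← hU]
      rfl
  obtain ⟨b, hb0, hb⟩ := (ClassGroup.mk_eq_one_of_coe_ideal hU).1 h1
  have : Ideal.span {r} = Ideal.span {(b : R)} := by
    rw [← hmap, hb, Ideal.map_span, Set.image_singleton]; rfl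
  obtain ⟨ε, hε⟩ := (Ideal.span_singleton_eq_span_singleton.1 this).symm
  exact ⟨b, ε, b.2, by rw [← hε, mul_comm]⟩

end Conductor

section Orders

variable {R : Type u} [CommRing R] [IsDedekindDomain R] {O : Subring R}

/-- Let `a ∈ O` and let `r ∈ R` be such that `rR` and `aR` differ by ideals coprime to the
conductor. Then some associate of `r` in `R` lies in `O`, and it differs from `a` by elements of `O`
coprime to the conductor. -/
theorem exists_unit_mul_mem (hTorsion : ∀ g : ClassGroup R, IsOfFinOrder g)
    (hfin : Finite (R ⧸ orderConductor O))
    (hPic : Function.Injective (ClassGroup.extendedHom O R)) {r a : R} (hr : r ≠ 0) (ha : a ∈ O)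
    (ha0 : a ≠ 0) {A B : Ideal R} (hA0 : A ≠ ⊥) (hA : IsCoprime A (orderConductor O))
    (hB : IsCoprime B (orderConductor O)) (h : Ideal.span {r} * A = Ideal.span {a} * B) :
    ∃ (ε : Rˣ) (b b' : R), b ∈ O ∧ b' ∈ O ∧ IsCoprime (Ideal.span {b}) (orderConductor O) ∧
      IsCoprime (Ideal.span {b'}) (orderConductor O) ∧ r * ε ∈ O ∧ r * ε * b' = a * b := by
  obtain ⟨m, s, hm, hs0, hs⟩ := exists_pow_eq_span hTorsion hA0
  obtain ⟨j, rfl⟩ : ∃ j, m = j + 1 := ⟨m - 1, by omega⟩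
  have hrs : Ideal.span {r * s} = Ideal.span {a} * (B * A ^ j) := by
    rw [← Ideal.span_singleton_mul_span_singleton, ← hs, pow_succ', ← mul_assoc, h, mul_assoc]
  obtain ⟨w, hw⟩ : a ∣ r * s := by
    rw [← Ideal.mem_span_singleton, ← Ideal.span_singleton_le_iff_mem, hrs]
    exact Ideal.mul_le_left
  have hw0 : w ≠ 0 := by
    rintro rfl
    exact mul_ne_zero hr hs0 (by simpa using hw)
  have hws : Ideal.span {w} = B * A ^ j := by
    rw [hw, ← Ideal.span_singleton_mul_span_singleton] at hrs
    exact mul_left_cancel₀ (by simpa using ha0) hrs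
  have hwf : IsCoprime (Ideal.span {w}) (orderConductor O) := by
    rw [hws]; exact hB.mul_left hA.pow_left
  have hsf : IsCoprime (Ideal.span {s}) (orderConductor O) := by
    rw [← hs]; exact hA.pow_left
  obtain ⟨b, ε, hb, rfl⟩ := exists_unit_mul_of_isCoprime hfin hPic hw0 hwf
  obtain ⟨b', ε', hb', rfl⟩ := exists_unit_mul_of_isCoprime hfin hPic hs0 hsf
  rw [Ideal.span_singleton_mul_left_unit ε.isUnit] at hwf
  rw [Ideal.span_singleton_mul_left_unit ε'.isUnit] at hsf
  have key : r * ((ε' * ε⁻¹ : Rˣ) : R) * b' = a * b := by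
    rw [Units.val_mul]
    linear_combination (ε⁻¹ : Rˣ) * hw + a * b * ε.inv_mul
  exact ⟨ε' * ε⁻¹, b, b', hb, hb', hwf, hsf,
    mem_of_mul_mem hfin hb' hsf (key ▸ O.mul_mem ha hb), key⟩

/-! ### Primes of `R` lying over the same prime of `O` -/

/-- A nonzero ideal is the product of its part at the primes satisfying `T` and its part at the
others. -/
theorem exists_mul_eq_of_pred (T : HeightOneSpectrum R → Prop) {I : Ideal R} (hI : I ≠ ⊥) :
    ∃ A S : Ideal R, I = A * S ∧ (∀ P : HeightOneSpectrum R, A ≤ P.asIdeal → T P) ∧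
      ∀ P : HeightOneSpectrum R, S ≤ P.asIdeal → ¬ T P := by
  induction I using UniqueFactorizationMonoid.induction_on_prime with
  | h₁ => exact absurd rfl hI
  | h₂ I hu =>
    rw [Ideal.isUnit_iff] at hu
    have h : ∀ P : HeightOneSpectrum R, ¬ (⊤ ≤ P.asIdeal) := fun P hP ↦
      P.isPrime.ne_top (top_le_iff.1 hP)
    exact ⟨⊤, ⊤, by simp [hu], fun P hP ↦ (h P hP).elim, fun P hP ↦ (h P hP).elim⟩
  | h₃ I p hI0 hp ih =>
    obtain ⟨A, S, rfl, hA, hS⟩ := ih hI0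
    let p' : HeightOneSpectrum R := ⟨p, Ideal.isPrime_of_prime hp, hp.ne_zero⟩
    have hle : ∀ (P : HeightOneSpectrum R) (J : Ideal R), p * J ≤ P.asIdeal →
        P = p' ∨ J ≤ P.asIdeal := by
      intro P J h
      refine ((P.isPrime.mul_le).1 h).imp_left fun h ↦ HeightOneSpectrum.ext ?_
      exact ((p'.isMaximal.eq_of_le P.isPrime.ne_top h)).symm
    by_cases hT : T p'
    · refine ⟨p * A, S, (mul_assoc _ _ _).symm, fun P h ↦ ?_, hS⟩
      rcases hle P A h with rfl | h
      exacts [hT, hA P h]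
    · refine ⟨A, p * S, mul_left_comm _ _ _, hA, fun P h ↦ ?_⟩
      rcases hle P S h with rfl | h
      exacts [hT, hS P h]

theorem isUnit_map_of_isUnit {B : Type v} [CommMonoid B] (Θ : R⁰ →* B) {r : R⁰}
    (hr : IsUnit (r : R)) : IsUnit (Θ r) := by
  obtain ⟨ε, hε⟩ := hr
  let s : R⁰ := ⟨(ε⁻¹ : Rˣ), mem_nonZeroDivisors_of_ne_zero (ε⁻¹).ne_zero⟩
  refine IsUnit.of_mul_eq_one (Θ s) ?_
  have : r * s = 1 := Subtype.ext (by
    change (r : R) * (ε⁻¹ : Rˣ) = 1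
    rw [← hε, ε.mul_inv])
  rw [← map_mul, this, map_one]

/-- If two primes `P ≠ Q` of `R` lie over the same prime of `O`, a generator `π` of a power of `P`
is sent to a unit: otherwise `h * π ^ N`, with `h` in the conductor, would split in `O` into at
least `N` factors, each of which is divisible by some prime other than `P`; but the number of those
primes in `h * π ^ N` does not depend on `N`. -/
theorem IsTransferOn.isUnit_of_span_eq_pow {B : Type v} [CancelCommMonoid B] {Θ : R⁰ →* B}
    (hΘ : IsTransferOn O Θ) (hf : orderConductor O ≠ ⊥) {P Q : HeightOneSpectrum R} (hPQ : Q ≠ P)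
    (hu : Q.asIdeal.under O = P.asIdeal.under O) {π : R⁰} {m : ℕ}
    (hπ : Ideal.span {(π : R)} = P.asIdeal ^ m) : IsUnit (Θ π) := by
  classical
  by_contra hnu
  obtain ⟨h, hh, hh0⟩ := Submodule.exists_mem_ne_zero_of_ne_bot hf
  let cnt : R⁰ → ℕ := fun r ↦
    (UniqueFactorizationMonoid.normalizedFactors (Ideal.span {(r : R)})).countP (· ≠ P.asIdeal)
  have hne : ∀ r : R⁰, Ideal.span {(r : R)} ≠ 0 := fun r ↦ by
    simp
  have cnt_mul : ∀ r s, cnt (r * s) = cnt r + cnt s := by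
    intro r s
    simp only [cnt]
    rw [Submonoid.coe_mul, ← Ideal.span_singleton_mul_span_singleton,
      UniqueFactorizationMonoid.normalizedFactors_mul (hne r) (hne s), Multiset.countP_add]
  have cnt_π : ∀ n, cnt (π ^ n) = 0 := by
    intro n
    simp only [cnt]
    rw [SubmonoidClass.coe_pow, ← Ideal.span_singleton_pow, hπ, ← pow_mul,
      UniqueFactorizationMonoid.normalizedFactors_pow,
      UniqueFactorizationMonoid.normalizedFactors_irreducible P.irreducible, normalize_eq,
      Multiset.countP_nsmul]
    simp [Multiset.countP_eq_zero]
  have cnt_pos : ∀ e : R⁰, (e : R) ∈ O → ¬ IsUnit (Θ e) → 1 ≤ cnt e := by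
    intro e he hnu
    obtain ⟨M, hM, hP'⟩ := exists_max_ideal_of_mem_nonunits
      fun h ↦ hnu (isUnit_map_of_isUnit Θ h)
    let P' : HeightOneSpectrum R := ⟨M, hM.isPrime, by
      rintro rfl
      exact nonZeroDivisors.ne_zero e.2 hP'⟩
    obtain ⟨Q', hQ', hne'⟩ : ∃ Q' : HeightOneSpectrum R, (e : R) ∈ Q'.asIdeal ∧ Q' ≠ P := by
      by_cases h : P' = P
      · exact ⟨Q, (Ideal.ext_iff.1 hu ⟨e, he⟩).2 (h ▸ hP'), hPQ⟩
      · exact ⟨P', hP', h⟩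
    refine Multiset.countP_pos.2 ⟨Q'.asIdeal, ?_, fun h ↦ hne' (HeightOneSpectrum.ext h)⟩
    rw [Ideal.mem_normalizedFactors_iff (hne e)]
    exact ⟨Q'.isPrime, (Ideal.span_singleton_le_iff_mem _).2 hQ'⟩
  let h' : R⁰ := ⟨h, mem_nonZeroDivisors_of_ne_zero hh0⟩
  obtain ⟨y, z, -, hz, hyz, -, hz'⟩ := hΘ.exists_factorization (h' * π ^ (cnt h' + 1)) (Θ h')
    (Θ π ^ (cnt h' + 1)) (hh _) (by rw [map_mul, map_pow])
  obtain ⟨s, hs, rfl, hs'⟩ := hΘ.exists_multiset (cnt h') hz hz'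
  have hcard : ∀ t : Multiset R⁰, (∀ x ∈ t, x ∈ s) → t.card ≤ cnt t.prod := by
    intro t
    induction t using Multiset.induction with
    | empty => simp
    | cons a t ih =>
      intro ht
      have ha := hs' a (ht a (Multiset.mem_cons_self a t))
      have := cnt_pos a ha.1 fun h ↦ hnu (ha.2.isUnit h)
      have := ih fun x hx ↦ ht x (Multiset.mem_cons_of_mem hx)
      rw [Multiset.card_cons, Multiset.prod_cons, cnt_mul]
      omega
  have h1 := hcard s fun _ h ↦ h
  have h2 := congrArg cnt hyz
  rw [cnt_mul, cnt_mul, cnt_π] at h2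
  omega

/-- `Θ r` is a unit if every prime divisor of `r` has the same contraction to `O` as some other prime
of `R`: a power of `r` is associated to a product of generators of powers of such primes. -/
theorem IsTransferOn.isUnit_of_forall {B : Type v} [CancelCommMonoid B] {Θ : R⁰ →* B}
    (hΘ : IsTransferOn O Θ) (hf : orderConductor O ≠ ⊥)
    (hTorsion : ∀ g : ClassGroup R, IsOfFinOrder g) {r : R⁰}
    (hr : ∀ P : HeightOneSpectrum R, (r : R) ∈ P.asIdeal →
      ∃ Q : HeightOneSpectrum R, Q ≠ P ∧ Q.asIdeal.under O = P.asIdeal.under O) :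
    IsUnit (Θ r) := by
  have hgen : ∀ A : Ideal R, A ≠ ⊥ → (∀ P : HeightOneSpectrum R, A ≤ P.asIdeal →
      ∃ Q : HeightOneSpectrum R, Q ≠ P ∧ Q.asIdeal.under O = P.asIdeal.under O) →
      ∃ (m : ℕ) (α : R⁰), 0 < m ∧ A ^ m = Ideal.span {(α : R)} ∧ IsUnit (Θ α) := by
    intro A hA h
    induction A using UniqueFactorizationMonoid.induction_on_prime with
    | h₁ => exact absurd rfl hA
    | h₂ I hu =>
      rw [Ideal.isUnit_iff] at hu
      exact ⟨1, 1, one_pos, by simp [hu], by simp⟩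
    | h₃ I p hI0 hp ih =>
      obtain ⟨m, α, hm, hα, hu⟩ := ih hI0 fun P hP ↦ h P (Ideal.mul_le_right.trans hP)
      let p' : HeightOneSpectrum R := ⟨p, Ideal.isPrime_of_prime hp, hp.ne_zero⟩
      obtain ⟨Q, hQ, hQu⟩ := h p' Ideal.mul_le_left
      obtain ⟨n, β, hn, hβ0, hβ⟩ := exists_pow_eq_span hTorsion p'.ne_bot
      let β' : R⁰ := ⟨β, mem_nonZeroDivisors_of_ne_zero hβ0⟩
      have hβu : IsUnit (Θ β') := hΘ.isUnit_of_span_eq_pow hf hQ hQu hβ.symm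
      refine ⟨n * m, β' ^ m * α ^ n, Nat.mul_pos hn hm, ?_, ?_⟩
      · rw [mul_pow, pow_mul, mul_comm n m, pow_mul, hα]
        change (p'.asIdeal ^ n) ^ m * _ = _
        rw [hβ, Submonoid.coe_mul, ← Ideal.span_singleton_mul_span_singleton, SubmonoidClass.coe_pow,
          SubmonoidClass.coe_pow, Ideal.span_singleton_pow, Ideal.span_singleton_pow]
      · rw [map_mul, map_pow, map_pow]
        exact (hβu.pow m).mul (hu.pow n)
  obtain ⟨m, α, hm, hα, hu⟩ := hgen (Ideal.span {(r : R)}) (by simp)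
    fun P hP ↦ hr P ((Ideal.span_singleton_le_iff_mem _).1 hP)
  rw [Ideal.span_singleton_pow, Ideal.span_singleton_eq_span_singleton] at hα
  obtain ⟨ε, hε⟩ := hα.symm
  have : Θ r ^ m = Θ (α * ⟨ε, mem_nonZeroDivisors_of_ne_zero ε.ne_zero⟩) := by
    rw [← map_pow]
    congr 1
    exact Subtype.ext hε.symm
  rw [← isUnit_pow_iff hm.ne', this, map_mul]
  exact hu.mul (isUnit_map_of_isUnit Θ ε.isUnit)

/-- The prime `P ∩ O` is not contained in the union of the other primes of `O` that contain the
conductor. -/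
theorem exists_mem_forall_notMem [Algebra.IsIntegral O R] (hf : orderConductor O ≠ ⊥)
    (P : HeightOneSpectrum R) : ∃ x : R, x ∈ O ∧ x ≠ 0 ∧ x ∈ P.asIdeal ∧
      ∀ P' : HeightOneSpectrum R, P'.asIdeal ∣ orderConductor O →
        P'.asIdeal.under O ≠ P.asIdeal.under O → x ∉ P'.asIdeal := by
  classical
  let T : Finset (Ideal O) := insert ⊥ ((((Ideal.finite_factors hf).toFinset).image
    fun P' ↦ P'.asIdeal.under O).erase (P.asIdeal.under O))
  have hmax : ∀ P' : HeightOneSpectrum R, (P'.asIdeal.under O).IsMaximal := fun P' ↦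
    have := P'.isMaximal
    Ideal.isMaximal_comap_of_isIntegral_of_isMaximal P'.asIdeal
  have hnot : ¬ ((P.asIdeal.under O : Set O) ⊆ ⋃ i ∈ (T : Set (Ideal O)), ((id i : Ideal O) : Set O)) := by
    rw [Ideal.subset_union_prime ⊥ ⊥]
    · rintro ⟨i, hi, hle⟩
      rcases Finset.mem_insert.1 hi with rfl | hi
      · obtain ⟨h, hh, hh0⟩ := Submodule.exists_mem_ne_zero_of_ne_bot hf
        obtain ⟨ϖ, hϖ, hϖ0⟩ := Submodule.exists_mem_ne_zero_of_ne_bot P.ne_bot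
        have h1 : (⟨h * ϖ, hh ϖ⟩ : O) ∈ P.asIdeal.under O := Ideal.mul_mem_left P.asIdeal h hϖ
        exact mul_ne_zero hh0 hϖ0 (congrArg Subtype.val (Ideal.mem_bot.1 (hle h1)))
      · obtain ⟨hne, hi⟩ := Finset.mem_erase.1 hi
        obtain ⟨P', -, rfl⟩ := Finset.mem_image.1 hi
        exact hne ((hmax P).eq_of_le (hmax P').ne_top hle).symm
    · intro i hi h _
      rcases Finset.mem_insert.1 hi with rfl | hi
      · exact absurd rfl h
      · obtain ⟨P', -, rfl⟩ := Finset.mem_image.1 (Finset.mem_of_mem_erase hi)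
        exact (hmax P').isPrime
  obtain ⟨x, hxP, hx⟩ := Set.not_subset.1 hnot
  simp only [Set.mem_iUnion, not_exists] at hx
  refine ⟨x, x.2, fun h ↦ ?_, hxP, fun P' hP' hne hmem ↦ ?_⟩
  · exact hx ⊥ (Finset.mem_insert_self _ _) (Ideal.mem_bot.2 (Subtype.ext h))
  · exact hx (P'.asIdeal.under O) (Finset.mem_insert_of_mem (Finset.mem_erase.2
      ⟨hne, Finset.mem_image_of_mem _ ((Ideal.finite_factors hf).mem_toFinset.2 hP')⟩)) hmem

/-- If `P ≠ Q` lay over the same prime of `O`, then `O` would contain an element `α ^ k` of `P` all of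
whose prime divisors lie over `P ∩ O`, so that its image would be a unit. Here `α` is the part at
those primes of a power of `x ∈ P ∩ O`, and the complementary part `σ` is coprime to the conductor,
so that `σ ^ k ≡ 1` and `α ^ k ≡ (α * σ) ^ k` modulo the conductor. -/
theorem IsTransferOn.eq_of_under_eq [Algebra.IsIntegral O R] {B : Type v} [CancelCommMonoid B]
    {Θ : R⁰ →* B} (hΘ : IsTransferOn O Θ) (hf : orderConductor O ≠ ⊥)
    (hfin : Finite (R ⧸ orderConductor O))
    (hTorsion : ∀ g : ClassGroup R, IsOfFinOrder g) {P Q : HeightOneSpectrum R}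
    (hu : Q.asIdeal.under O = P.asIdeal.under O) : Q = P := by
  by_contra hPQ
  obtain ⟨x, hxO, hx0, hxP, hx⟩ := exists_mem_forall_notMem hf P
  obtain ⟨A, S, hAS, hA, hS⟩ := exists_mul_eq_of_pred
    (fun P' ↦ P'.asIdeal.under O = P.asIdeal.under O) (I := Ideal.span {x}) (by simpa using hx0)
  have hS0 : S ≠ ⊥ := by
    rintro rfl
    exact hx0 (by simpa using hAS)
  have hSf : IsCoprime S (orderConductor O) := by
    rw [isCoprime_orderConductor_iff hf]
    intro P' hP' hle
    refine hx P' hP' (hS P' hle) ?_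
    rw [← Ideal.span_singleton_le_iff_mem, hAS]
    exact Ideal.mul_le_right.trans hle
  obtain ⟨m, σ, hm, hσ0, hσ⟩ := exists_pow_eq_span hTorsion hS0
  have hxm : Ideal.span {x ^ m} = A ^ m * Ideal.span {σ} := by
    rw [← Ideal.span_singleton_pow, hAS, mul_pow, hσ]
  obtain ⟨α, hα⟩ : σ ∣ x ^ m := by
    rw [← Ideal.mem_span_singleton, ← Ideal.span_singleton_le_iff_mem, hxm]
    exact Ideal.mul_le_right
  have hαA : Ideal.span {α} = A ^ m := by
    rw [hα, mul_comm, ← Ideal.span_singleton_mul_span_singleton] at hxm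
    exact mul_right_cancel₀ (by simpa using hσ0) hxm
  obtain ⟨k, hk, hkf⟩ := exists_pow_sub_one_mem hfin (r := σ) (by rw [← hσ]; exact hSf.pow_left)
  have hαk : α ^ k ∈ O := by
    have h1 := hkf (α ^ k)
    have h2 : α ^ k = (x ^ m) ^ k - (σ ^ k - 1) * α ^ k := by rw [hα]; ring
    rw [h2]
    exact O.sub_mem (O.pow_mem (O.pow_mem hxO m) k) h1
  have hα0 : α ≠ 0 := by
    rintro rfl
    exact pow_ne_zero m hx0 (by simpa using hα)
  have hAP : A ≤ P.asIdeal := by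
    have h : A * S ≤ P.asIdeal := by rwa [← hAS, Ideal.span_singleton_le_iff_mem]
    exact (P.isPrime.mul_le.1 h).resolve_right fun h ↦ hS P h rfl
  have hαP : α ∈ P.asIdeal := by
    rw [← Ideal.span_singleton_le_iff_mem, hαA]
    exact (Ideal.pow_le_self hm.ne').trans hAP
  let α' : R⁰ := ⟨α, mem_nonZeroDivisors_of_ne_zero hα0⟩
  have hunit : IsUnit (Θ α') := by
    refine hΘ.isUnit_of_forall hf hTorsion fun P' hP' ↦ ?_
    have hT : P'.asIdeal.under O = P.asIdeal.under O := by
      refine hA P' ?_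
      rw [← Ideal.span_singleton_le_iff_mem] at hP'
      change Ideal.span {α} ≤ _ at hP'
      rw [hαA] at hP'
      exact P'.isPrime.le_of_pow_le hP'
    by_cases h : P' = P
    · exact ⟨Q, h ▸ hPQ, hu.trans hT.symm⟩
    · exact ⟨P, fun h' ↦ h h'.symm, hT.symm⟩
  have : IsUnit (α ^ k) := hΘ.isUnit_of_isUnit (α' ^ k) hαk (by rw [map_pow]; exact hunit.pow k)
  exact P.isPrime.ne_top (Ideal.eq_top_of_isUnit_mem _ (Ideal.pow_mem_of_mem _ hαP k hk) this)

end Orders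

section Valuation

variable {R : Type u} [CommRing R] [IsDedekindDomain R] {O : Subring R}

/-! ### The `P`-adic valuation and the atoms of `O_𝔭` -/

/-- The `P`-adic valuation on `R`, with value `⊤` at `0`. -/
noncomputable def val (P : HeightOneSpectrum R) (r : R) : ℕ∞ :=
  emultiplicity P.asIdeal (Ideal.span {r})

theorem val_mul (P : HeightOneSpectrum R) (r s : R) : val P (r * s) = val P r + val P s := by
  rw [val, ← Ideal.span_singleton_mul_span_singleton, emultiplicity_mul P.prime]
  rfl

theorem val_eq_zero_iff {P : HeightOneSpectrum R} {r : R} : val P r = 0 ↔ r ∉ P.asIdeal := by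
  rw [val, emultiplicity_eq_zero, Ideal.dvd_span_singleton]

theorem one_le_val_iff {P : HeightOneSpectrum R} {r : R} : 1 ≤ val P r ↔ r ∈ P.asIdeal := by
  rw [Order.one_le_iff_ne_zero, ne_eq, val_eq_zero_iff, not_not]

theorem exists_val_eq (P : HeightOneSpectrum R) {r : R} (hr : r ≠ 0) : ∃ k : ℕ, val P r = k := by
  have h : FiniteMultiplicity P.asIdeal (Ideal.span {r}) :=
    FiniteMultiplicity.of_prime_left P.prime (by simpa using hr)
  exact ⟨_, h.emultiplicity_eq_multiplicity⟩

theorem val_eq_iff {P : HeightOneSpectrum R} {r : R} {k : ℕ} :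
    val P r = k ↔ ∃ S : Ideal R, Ideal.span {r} = P.asIdeal ^ k * S ∧ ¬ S ≤ P.asIdeal := by
  rw [val, emultiplicity_eq_coe]
  constructor
  · rintro ⟨⟨S, hS⟩, h⟩
    refine ⟨S, hS, fun hle ↦ h ?_⟩
    rw [hS, pow_succ]
    exact mul_dvd_mul_left _ (Ideal.dvd_iff_le.2 hle)
  · rintro ⟨S, hS, h⟩
    refine ⟨⟨S, hS⟩, fun hd ↦ h ?_⟩
    rw [hS, pow_succ] at hd
    exact Ideal.le_of_dvd ((mul_dvd_mul_iff_left (pow_ne_zero k P.ne_bot)).1 hd)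

/-- The element `x ∈ O` is, up to a unit, an atom of the localization of `O` at `P ∩ O`. -/
structure IsLocalAtom (O : Subring R) (P : HeightOneSpectrum R) (x : R) : Prop where
  mem : x ∈ P.asIdeal
  notMem_or_notMem : ∀ y z s : R, y ∈ O → z ∈ O → s ∈ O → s ∉ P.asIdeal → x * s = y * z →
    y ∉ P.asIdeal ∨ z ∉ P.asIdeal

/-- Assume that distinct primes of `R` lie over distinct primes of `O`. Every nonzero `x ∈ O` is
associated, in the localization at `P ∩ O`, to an element `a ∈ O` that avoids all other primes
containing the conductor. -/
theorem exists_local_associate [Algebra.IsIntegral O R] (hf : orderConductor O ≠ ⊥)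
    (hfin : Finite (R ⧸ orderConductor O))
    (huniq : ∀ P Q : HeightOneSpectrum R, Q.asIdeal.under O = P.asIdeal.under O → Q = P)
    {P : HeightOneSpectrum R} (hP : P.asIdeal ∣ orderConductor O) {x : R} (hxO : x ∈ O) {k : ℕ}
    (hk : val P x = k) :
    ∃ (a σ τ : R) (S : Ideal R), a ∈ O ∧ σ ∈ O ∧ τ ∈ O ∧ σ ∉ P.asIdeal ∧ τ ∉ P.asIdeal ∧
      a * σ = x * τ ∧ a ≠ 0 ∧ S ≠ ⊥ ∧ Ideal.span {a} = P.asIdeal ^ k * S ∧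
      IsCoprime S (orderConductor O) := by
  obtain ⟨S, hS, hSP⟩ := val_eq_iff.1 hk
  have hx0 : x ≠ 0 := by
    rintro rfl
    have := hk
    rw [val, Set.singleton_zero, Ideal.span_zero, ← Ideal.zero_eq_bot, emultiplicity_zero] at this
    exact ENat.natCast_ne_top k this.symm
  have hS0 : S ≠ ⊥ := by
    rintro rfl
    exact hSP bot_le
  have := P.isPrime
  obtain ⟨w, hwO, hw0, hwP, hw⟩ := exists_mem_forall_notMem hf P
  -- With `e = 1 - w ^ d`, the element `w ^ (i + 1) * e` lies in the `(k + 1)`-st power of the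
  -- conductor, hence is locally a multiple of `x`. So `a = x * e + w ^ (i + 1)` is locally
  -- associated to `x`, and it is congruent to `w ^ (i + 1)` modulo each prime that contains `e`.
  have hfin' := Ideal.finite_quotient_pow (IsNoetherian.noetherian (orderConductor O)) (k + 1)
  obtain ⟨i, d, hd, hid⟩ : ∃ i d : ℕ, 0 < d ∧ w ^ i * (1 - w ^ d) ∈ orderConductor O ^ (k + 1) := by
    obtain ⟨i, j, hij, h⟩ := Finite.exists_ne_map_eq_of_infinite
      fun n : ℕ ↦ Ideal.Quotient.mk (orderConductor O ^ (k + 1)) (w ^ n)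
    wlog hlt : i < j generalizing i j
    · exact this j i hij.symm h.symm (by omega)
    refine ⟨i, j - i, by omega, ?_⟩
    have h' := Ideal.Quotient.eq.1 h
    have he : w ^ i * (1 - w ^ (j - i)) = w ^ i - w ^ j := by
      rw [mul_sub, mul_one, ← pow_add, Nat.add_sub_cancel' hlt.le]
    rwa [he]
  set e := 1 - w ^ d with he
  have heO : e ∈ O := O.sub_mem O.one_mem (O.pow_mem hwO d)
  have heP : e ∉ P.asIdeal := fun h ↦ P.isPrime.ne_top ((Ideal.eq_top_iff_one _).2 (by
    have := add_mem h (Ideal.pow_mem_of_mem _ hwP d hd)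
    rwa [he, sub_add_cancel] at this))
  have hc : w ^ (i + 1) * e ∈ orderConductor O ^ (k + 1) := by
    rw [pow_succ' w, mul_assoc]; exact Ideal.mul_mem_left _ _ hid
  obtain ⟨s, hsO, hsS, hsP⟩ : ∃ s : R, s ∈ O ∧ s ∈ S ∧ s ∉ P.asIdeal := by
    by_contra! hcon
    obtain ⟨Q, hSQ, hQ, hQP⟩ := Ideal.exists_ideal_over_prime_of_isIntegral (P.asIdeal.under O) S
      (fun s hs ↦ hcon s s.2 hs)
    have := huniq P ⟨Q, hQ, fun h ↦ hS0 (le_bot_iff.1 (h ▸ hSQ))⟩ hQP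
    rw [← this] at hSP
    exact hSP hSQ
  obtain ⟨y, hy, hyc⟩ : ∃ y ∈ orderConductor O, x * y = w ^ (i + 1) * e * s := by
    rw [← Ideal.mem_span_singleton_mul, hS, mul_right_comm]
    refine Ideal.mul_mem_mul ?_ hsS
    rw [pow_succ] at hc
    exact Ideal.mul_mono_left (Ideal.pow_right_mono (Ideal.le_of_dvd hP) k) hc
  have hyP := Ideal.le_of_dvd hP hy
  have hσ : e * s ∉ P.asIdeal := fun h ↦ (P.isPrime.mem_or_mem h).elim heP hsP
  have hτ : e ^ 2 * s + y ∉ P.asIdeal := fun h ↦ by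
    rw [Ideal.add_mem_iff_left _ hyP, pow_two, mul_assoc] at h
    exact (P.isPrime.mem_or_mem h).elim heP hσ
  have hστ : (x * e + w ^ (i + 1)) * (e * s) = x * (e ^ 2 * s + y) := by
    linear_combination -hyc
  have ha0 : x * e + w ^ (i + 1) ≠ 0 := by
    intro h
    rw [h, zero_mul, eq_comm, mul_eq_zero] at hστ
    rcases hστ with h | h
    · exact hx0 h
    · exact hτ (h ▸ zero_mem _)
  have hval : val P (x * e + w ^ (i + 1)) = k := by
    have := congrArg (val P) hστ
    rwa [val_mul P _ (e * s), val_mul P x, val_eq_zero_iff.2 hσ, val_eq_zero_iff.2 hτ, add_zero, add_zero, hk]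
      at this
  obtain ⟨S', hS', hSP'⟩ := val_eq_iff.1 hval
  refine ⟨x * e + w ^ (i + 1), e * s, e ^ 2 * s + y, S',
    O.add_mem (O.mul_mem hxO heO) (O.pow_mem hwO _), O.mul_mem heO hsO,
    O.add_mem (O.mul_mem (O.pow_mem heO 2) hsO) (mem_of_mem_orderConductor hy), hσ, hτ, hστ, ha0,
    fun h ↦ hSP' (h ▸ bot_le), hS', ?_⟩
  rw [isCoprime_orderConductor_iff hf]
  intro P' hP' hle
  by_cases hPP : P' = P
  · exact hSP' (hPP ▸ hle)
  · have hw' : w ∉ P'.asIdeal := hw P' hP' fun h ↦ hPP (huniq P P' h)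
    have hwi : w ^ (i + 1) ∉ P'.asIdeal := fun h ↦ hw' (P'.isPrime.mem_of_pow_mem _ h)
    have he' : e ∈ P'.asIdeal := (P'.isPrime.mem_or_mem
      (Ideal.le_of_dvd hP' (Ideal.pow_le_self k.succ_ne_zero hc))).resolve_left hwi
    refine hwi ((Ideal.add_mem_iff_right _ (Ideal.mul_mem_left _ x he')).1 ?_)
    rw [← Ideal.span_singleton_le_iff_mem, hS']
    exact Ideal.mul_le_right.trans hle

/-- Suppose `x` is an atom of the localization at `P ∩ O` with `v(x) = k + 1`, and `PJ = tR` with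
`J` coprime to the conductor. Some `α ∈ O` is locally associated to `x` and generates the ideal
`(PJ) ^ (k + 1) = t ^ (k + 1) R`. Lifting the factorization of its image as a power of the image of
`t`, the element `α` splits into `k + 1` nonunits of `O`; as `x` is an atom, all but one of them lie
outside `P`, so that they divide a power of `J`. -/
theorem IsLocalAtom.exists_multiset [Algebra.IsIntegral O R]
    (hTorsion : ∀ g : ClassGroup R, IsOfFinOrder g)
    (hf : orderConductor O ≠ ⊥) (hfin : Finite (R ⧸ orderConductor O))
    (hPic : Function.Injective (ClassGroup.extendedHom O R))
    (huniq : ∀ P Q : HeightOneSpectrum R, Q.asIdeal.under O = P.asIdeal.under O → Q = P)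
    {B : Type v} [CancelCommMonoid B] {Θ : R⁰ →* B} (hΘ : IsTransferOn O Θ)
    {P : HeightOneSpectrum R} (hP : P.asIdeal ∣ orderConductor O) {x : R} (hxO : x ∈ O)
    (hx : IsLocalAtom O P x) {k : ℕ} (hk : val P x = (k + 1 : ℕ)) {J : Ideal R} {t : R}
    (hJ : IsCoprime J (orderConductor O)) (ht0 : t ≠ 0)
    (ht : P.asIdeal * J = Ideal.span {t}) :
    ∃ s : Multiset R⁰, s.card = k ∧ (∀ e ∈ s, ¬ IsUnit (e : R)) ∧
      Ideal.span {(s.prod : R)} ∣ J ^ (k + 1) := by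
  classical
  obtain ⟨a, σ, τ, S, haO, hσO, hτO, hσ, hτ, hστ, ha0, hS0, hS, hSf⟩ :=
    exists_local_associate hf hfin huniq hP hxO hk
  have hG : Ideal.span {t ^ (k + 1)} * S = Ideal.span {a} * J ^ (k + 1) := by
    rw [← Ideal.span_singleton_pow, ← ht, hS, mul_pow]
    exact mul_right_comm _ _ _
  obtain ⟨ε, b, b', hbO, hb'O, hbf, -, hαO, hα⟩ := exists_unit_mul_mem hTorsion hfin hPic
    (pow_ne_zero (k + 1) ht0) haO ha0 hS0 hSf hJ.pow_left hG
  have hbP : b ∉ P.asIdeal := fun h ↦ (isCoprime_orderConductor_iff hf).1 hbf P hP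
    ((Ideal.span_singleton_le_iff_mem _).2 h)
  have hatom : ∀ y z : R, y ∈ O → z ∈ O → t ^ (k + 1) * ε = y * z →
      y ∉ P.asIdeal ∨ z ∉ P.asIdeal := by
    intro y z hy hz hyz
    have h := hx.notMem_or_notMem y (z * (b' * σ)) (τ * b) hy
      (O.mul_mem hz (O.mul_mem hb'O hσO)) (O.mul_mem hτO hbO)
      (fun h ↦ (P.isPrime.mem_or_mem h).elim hτ hbP)
      (by linear_combination (-b) * hστ - σ * hα + b' * σ * hyz)
    exact h.imp_right fun h hz' ↦ h (Ideal.mul_mem_right _ _ hz')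
  have htP : t ∈ P.asIdeal := by
    rw [← Ideal.span_singleton_le_iff_mem, ← ht]
    exact Ideal.mul_le_left
  have hαP : t ^ (k + 1) * ε ∈ P.asIdeal :=
    Ideal.mul_mem_right _ _ (Ideal.pow_mem_of_mem _ htP _ k.succ_pos)
  let t' : R⁰ := ⟨t, mem_nonZeroDivisors_of_ne_zero ht0⟩
  let ε' : R⁰ := ⟨ε, mem_nonZeroDivisors_of_ne_zero ε.ne_zero⟩
  have hε' : IsUnit (Θ ε') := isUnit_map_of_isUnit Θ ε.isUnit
  have hassoc : Associated (Θ (t' ^ (k + 1) * ε')) (Θ t' ^ (k + 1)) := by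
    rw [map_mul, map_pow]
    exact associated_mul_unit_left _ _ hε'
  have htu : ¬ IsUnit (Θ t') := fun h ↦ P.isPrime.ne_top
    (Ideal.eq_top_of_isUnit_mem _ hαP (hΘ.isUnit_of_isUnit (t' ^ (k + 1) * ε') hαO
      (hassoc.symm.isUnit (h.pow _))))
  obtain ⟨s, hs, hprod, hs'⟩ := hΘ.exists_multiset k (r := t' ^ (k + 1) * ε') hαO hassoc
  obtain ⟨e, he, heP⟩ : ∃ e ∈ s, (e : R) ∈ P.asIdeal := by
    have h : (s.map ((↑) : R⁰ → R)).prod ∈ P.asIdeal := by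
      rw [← Submonoid.coe_multiset_prod, hprod]; exact hαP
    rw [P.isPrime.multiset_prod_mem_iff_exists_mem] at h
    obtain ⟨_, h, hP⟩ := h
    obtain ⟨e, he, rfl⟩ := Multiset.mem_map.1 h
    exact ⟨e, he, hP⟩
  obtain ⟨s, rfl⟩ := Multiset.exists_cons_of_mem he
  rw [Multiset.prod_cons] at hprod
  have hprod' : t ^ (k + 1) * ε = e * (s.prod : R⁰) := (congrArg Subtype.val hprod).symm
  have hsO : ((s.prod : R⁰) : R) ∈ O :=
    Multiset.prod_induction (fun r : R⁰ ↦ (r : R) ∈ O) s (fun _ _ ↦ O.mul_mem) O.one_mem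
      fun r hr ↦ (hs' r (Multiset.mem_cons_of_mem hr)).1
  have hsP : ((s.prod : R⁰) : R) ∉ P.asIdeal :=
    (hatom _ _ (hs' e he).1 hsO hprod').resolve_left fun h ↦ h heP
  refine ⟨s, by simpa using hs, fun r hr hu ↦ ?_, ?_⟩
  · exact htu ((hs' r (Multiset.mem_cons_of_mem hr)).2.isUnit (isUnit_map_of_isUnit Θ hu))
  · have hcop : IsCoprime (Ideal.span {(s.prod : R)}) (P.asIdeal ^ (k + 1)) := by
      refine IsCoprime.pow_right ?_
      rw [Ideal.isCoprime_iff_sup_eq]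
      refine P.isMaximal.out.2 _ (right_lt_sup.2 fun h ↦ hsP ?_)
      exact (Ideal.span_singleton_le_iff_mem _).1 h
    refine hcop.dvd_of_dvd_mul_left ?_
    rw [← mul_pow, ht, Ideal.span_singleton_pow, Ideal.dvd_iff_le,
      Ideal.span_singleton_le_iff_mem, Ideal.mem_span_singleton,
      ← Units.dvd_mul_right (u := ε), hprod']
    exact dvd_mul_left _ _

end Valuation

section Atoms

variable {R : Type u} [CommRing R] [IsDedekindDomain R] {O : Subring R}

/-- An atom of the localization at `P ∩ O` of valuation `k ≥ 2` is possible only for `k = 2` and a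
class `[P]` of order `2`. If `P` is principal, `IsLocalAtom.exists_multiset` with `J = R` is already
contradictory for `k ≥ 2`. Otherwise take for `J` a prime `Q` in the class `[P]⁻¹`: the `k - 1`
principal ideals that divide `Q ^ k` are powers of `Q` with exponents divisible by `ord [P]`, so that
`(k - 1) * ord [P] ≤ k`. -/
theorem IsLocalAtom.val_eq [Algebra.IsIntegral O R]
    (hTorsion : ∀ g : ClassGroup R, IsOfFinOrder g)
    (hf : orderConductor O ≠ ⊥) (hfin : Finite (R ⧸ orderConductor O))
    (hPrimes : ∀ g : ClassGroup R, ∃ Q : HeightOneSpectrum R,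
      primeClass Q = g ∧ IsCoprime Q.asIdeal (orderConductor O))
    (hPic : Function.Injective (ClassGroup.extendedHom O R))
    (huniq : ∀ P Q : HeightOneSpectrum R, Q.asIdeal.under O = P.asIdeal.under O → Q = P)
    {B : Type v} [CancelCommMonoid B] {Θ : R⁰ →* B} (hΘ : IsTransferOn O Θ)
    {P : HeightOneSpectrum R} (hP : P.asIdeal ∣ orderConductor O) {x : R} (hxO : x ∈ O)
    (hx0 : x ≠ 0) (hx : IsLocalAtom O P x) :
    val P x = 1 ∨ val P x = 2 ∧ orderOf (primeClass P) = 2 := by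
  obtain ⟨k, hk⟩ := exists_val_eq P hx0
  have hk1 : 1 ≤ k := by
    have := one_le_val_iff.2 hx.mem
    rw [hk] at this
    exact_mod_cast this
  obtain ⟨k, rfl⟩ : ∃ j, k = j + 1 := ⟨k - 1, by omega⟩
  rcases Nat.eq_zero_or_pos k with rfl | hkpos
  · exact Or.inl (by simpa using hk)
  right
  have hn : 0 < orderOf (primeClass P) := (hTorsion _).orderOf_pos
  by_cases hn1 : orderOf (primeClass P) = 1
  · exfalso
    rw [orderOf_eq_one_iff, primeClass, ClassGroup.mk0_eq_one_iff] at hn1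
    obtain ⟨t, ht⟩ := hn1.principal
    have ht' : P.asIdeal * ⊤ = Ideal.span {t} := by rw [Ideal.mul_top]; exact ht
    have ht0 : t ≠ 0 := by
      rintro rfl
      exact P.ne_bot (by simpa using ht)
    obtain ⟨s, hs, hsu, hsd⟩ := hx.exists_multiset hTorsion hf hfin hPic huniq hΘ hP hxO hk
      (J := ⊤) (Ideal.isCoprime_iff_sup_eq.2 (top_sup_eq _)) ht0 ht'
    obtain ⟨e, he⟩ := Multiset.card_pos_iff_exists_mem.1 (hs ▸ hkpos)
    refine hsu e he (isUnit_of_dvd_unit (y := (s.prod : R)) ?_ ?_)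
    · obtain ⟨d, hd⟩ := Multiset.dvd_prod he
      exact ⟨d, congrArg Subtype.val hd⟩
    · rw [← Ideal.span_singleton_eq_top, ← Ideal.isUnit_iff]
      rw [← Ideal.one_eq_top, one_pow] at hsd
      exact isUnit_of_dvd_one hsd
  · obtain ⟨Q, hQ, hQf⟩ := hPrimes (primeClass P)⁻¹
    have hPQ : (P.asIdeal * Q.asIdeal).IsPrincipal := by
      rw [← ClassGroup.mk0_eq_one_iff (mul_mem (mem_nonZeroDivisors_of_ne_zero P.ne_bot)
        (mem_nonZeroDivisors_of_ne_zero Q.ne_bot))]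
      have h : primeClass P * primeClass Q = 1 := by rw [hQ, mul_inv_cancel]
      rw [← h, primeClass, primeClass, ← map_mul]
      rfl
    obtain ⟨t, ht⟩ := hPQ.principal
    have ht0 : t ≠ 0 := by
      rintro rfl
      exact mul_ne_zero P.ne_bot Q.ne_bot (by simpa using ht)
    obtain ⟨s, hs, hsu, hsd⟩ := hx.exists_multiset hTorsion hf hfin hPic huniq hΘ hP hxO hk
      hQf ht0 ht
    set n := orderOf (primeClass P) with hn'
    have hdvd : ∀ e ∈ s, Q.asIdeal ^ n ∣ Ideal.span {(e : R)} := by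
      intro e he
      have hd : Ideal.span {(e : R)} ∣ Q.asIdeal ^ (k + 1) := by
        refine dvd_trans ?_ hsd
        obtain ⟨d, hd⟩ := Multiset.dvd_prod he
        rw [hd, Submonoid.coe_mul, ← Ideal.span_singleton_mul_span_singleton]
        exact dvd_mul_right _ _
      obtain ⟨i, -, hi⟩ := (dvd_prime_pow Q.prime _).1 hd
      rw [associated_iff_eq] at hi
      have hQi : primeClass Q ^ i = 1 := by
        rw [primeClass, ← map_pow]
        refine (ClassGroup.mk0_eq_one_iff (pow_mem (mem_nonZeroDivisors_of_ne_zero Q.ne_bot) i)).2 ?_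
        rw [← hi]
        exact ⟨e, rfl⟩
      rw [← orderOf_dvd_iff_pow_eq_one, hQ, orderOf_inv] at hQi
      have hi0 : i ≠ 0 := by
        rintro rfl
        rw [pow_zero, Ideal.one_eq_top, Ideal.span_singleton_eq_top] at hi
        exact hsu e he hi
      rw [hi]
      exact pow_dvd_pow _ (Nat.le_of_dvd (Nat.pos_of_ne_zero hi0) hQi)
    have hprod : ∀ u : Multiset R⁰, (∀ e ∈ u, e ∈ s) →
        Q.asIdeal ^ (n * u.card) ∣ Ideal.span {(u.prod : R)} := by
      intro u
      induction u using Multiset.induction with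
      | empty => simp
      | cons a u ih =>
        intro hu
        rw [Multiset.card_cons, mul_add_one, add_comm, pow_add, Multiset.prod_cons,
          Submonoid.coe_mul, ← Ideal.span_singleton_mul_span_singleton]
        exact mul_dvd_mul (hdvd a (hu a (Multiset.mem_cons_self a u)))
          (ih fun e he ↦ hu e (Multiset.mem_cons_of_mem he))
    have hle := (hprod s fun _ h ↦ h).trans hsd
    rw [hs, pow_dvd_pow_iff Q.ne_bot Q.prime.not_isUnit] at hle
    have hn2 : 2 ≤ n := by omega
    have h1 : 2 * k ≤ n * k := Nat.mul_le_mul_right k hn2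
    have hk' : k = 1 := by omega
    subst hk'
    exact ⟨by simpa using hk, by omega⟩

/-- `O` contains an element of `P`-valuation `1`. The conductor contains elements of every large
valuation; an element of `O` of minimal odd valuation is an atom of the localization, as a factor of
it would again have odd valuation. -/
theorem exists_val_eq_one (hf : orderConductor O ≠ ⊥) {P : HeightOneSpectrum R}
    (hatom : ∀ x : R, x ∈ O → x ≠ 0 → IsLocalAtom O P x → val P x = 1 ∨ val P x = 2) :
    ∃ x : R, x ∈ O ∧ x ≠ 0 ∧ val P x = 1 := by
  classical
  have hex : ∃ k : ℕ, Odd k ∧ ∃ x : R, x ∈ O ∧ x ≠ 0 ∧ val P x = k := by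
    obtain ⟨h, hh, hh0⟩ := Submodule.exists_mem_ne_zero_of_ne_bot hf
    obtain ⟨k, hk⟩ := exists_val_eq P hh0
    rcases Nat.even_or_odd k with he | ho
    · obtain ⟨ϖ, h1, h2⟩ := Ideal.exists_mem_pow_notMem_pow_succ P.asIdeal P.ne_bot
        P.isPrime.ne_top 1
      have hϖ : val P ϖ = (1 : ℕ) := by
        rw [val, emultiplicity_eq_coe, Ideal.dvd_span_singleton, Ideal.dvd_span_singleton]
        exact ⟨h1, h2⟩
      have hϖ0 : ϖ ≠ 0 := by
        rintro rfl
        exact h2 (zero_mem _)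
      exact ⟨k + 1, he.add_one, h * ϖ, hh ϖ, mul_ne_zero hh0 hϖ0, by
        rw [val_mul, hk, hϖ]; push_cast; rfl⟩
    · exact ⟨k, ho, h, mem_of_mem_orderConductor hh, hh0, hk⟩
  obtain ⟨hodd, x, hxO, hx0, hx⟩ := Nat.find_spec hex
  set k := Nat.find hex
  have hxP : x ∈ P.asIdeal := by
    rw [← one_le_val_iff, hx]
    exact_mod_cast hodd.pos
  refine ⟨x, hxO, hx0, ?_⟩
  have hxa : IsLocalAtom O P x := by
    refine ⟨hxP, fun y z s hy hz hs hsP h ↦ ?_⟩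
    by_contra! hcon
    have hne : y * z ≠ 0 := by
      rw [← h]
      exact mul_ne_zero hx0 fun h ↦ hsP (h ▸ zero_mem _)
    obtain ⟨a, ha⟩ := exists_val_eq P (left_ne_zero_of_mul hne)
    obtain ⟨b, hb⟩ := exists_val_eq P (right_ne_zero_of_mul hne)
    have hab := congrArg (val P) h
    rw [val_mul, val_mul, val_eq_zero_iff.2 hsP, hx, ha, hb, add_zero] at hab
    have ha1 := one_le_val_iff.2 hcon.1
    have hb1 := one_le_val_iff.2 hcon.2
    rw [ha] at ha1
    rw [hb] at hb1
    norm_cast at hab ha1 hb1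
    rcases Nat.even_or_odd a with hae | hao
    · have hbo : Odd b := by
        rw [hab] at hodd
        by_contra h
        rw [Nat.not_odd_iff_even] at h
        exact (Nat.not_odd_iff_even.2 (hae.add h)) hodd
      have : k ≤ b := Nat.find_min' hex ⟨hbo, z, hz, right_ne_zero_of_mul hne, hb⟩
      omega
    · have : k ≤ a := Nat.find_min' hex ⟨hao, y, hy, left_ne_zero_of_mul hne, ha⟩
      omega
  refine (hatom x hxO hx0 hxa).resolve_right fun h2 ↦ ?_
  rw [hx] at h2
  norm_cast at h2
  rw [h2] at hodd
  exact absurd hodd (by decide)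

/-! ### The equality `O · Rˣ = R` -/

/-- If `O` contains elements of valuation `1` at each prime dividing the conductor, then each ideal of
`R` agrees, up to ideals coprime to the conductor, with a principal ideal generated by an element of
`O`, and `exists_unit_mul_mem` applies. -/
theorem exists_eq_mul_unit [Algebra.IsIntegral O R]
    (hTorsion : ∀ g : ClassGroup R, IsOfFinOrder g)
    (hf : orderConductor O ≠ ⊥) (hfin : Finite (R ⧸ orderConductor O))
    (hPic : Function.Injective (ClassGroup.extendedHom O R))
    (huniq : ∀ P Q : HeightOneSpectrum R, Q.asIdeal.under O = P.asIdeal.under O → Q = P)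
    (hval : ∀ P : HeightOneSpectrum R, P.asIdeal ∣ orderConductor O →
      ∃ x : R, x ∈ O ∧ x ≠ 0 ∧ val P x = 1) (r : R) :
    ∃ a : O, ∃ ε : Rˣ, r = a * ε := by
  have hgen : ∀ I : Ideal R, I ≠ ⊥ → ∃ (a : R) (A B : Ideal R), a ∈ O ∧ a ≠ 0 ∧ A ≠ ⊥ ∧
      IsCoprime A (orderConductor O) ∧ IsCoprime B (orderConductor O) ∧
      I * A = Ideal.span {a} * B := by
    intro I hI
    induction I using UniqueFactorizationMonoid.induction_on_prime with
    | h₁ => exact absurd rfl hI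
    | h₂ I hu =>
      rw [Ideal.isUnit_iff] at hu
      exact ⟨1, 1, 1, O.one_mem, one_ne_zero, one_ne_zero, isCoprime_one_left, isCoprime_one_left,
        by simp [hu]⟩
    | h₃ I p hI0 hp ih =>
      obtain ⟨a, A, B, ha, ha0, hA0, hA, hB, h⟩ := ih hI0
      let P : HeightOneSpectrum R := ⟨p, Ideal.isPrime_of_prime hp, hp.ne_zero⟩
      by_cases hP : P.asIdeal ∣ orderConductor O
      · obtain ⟨x, hxO, hx0, hx⟩ := hval P hP
        obtain ⟨a', -, -, S, ha', -, -, -, -, -, ha'0, hS0, hS, hSf⟩ :=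
          exists_local_associate hf hfin huniq hP hxO (k := 1) (by simpa using hx)
        refine ⟨a' * a, S * A, B, O.mul_mem ha' ha, mul_ne_zero ha'0 ha0, mul_ne_zero hS0 hA0,
          hSf.mul_left hA, hB, ?_⟩
        rw [← Ideal.span_singleton_mul_span_singleton, mul_assoc (Ideal.span {a'}), ← h, hS, pow_one]
        exact mul_mul_mul_comm _ _ _ _
      · refine ⟨a, A, P.asIdeal * B, ha, ha0, hA0, hA, IsCoprime.mul_left ?_ hB, ?_⟩
        · rw [isCoprime_orderConductor_iff hf]
          intro P' hP' hle
          rw [← P.isMaximal.eq_of_le P'.isPrime.ne_top hle] at hP'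
          exact hP hP'
        · rw [mul_left_comm, ← h, mul_assoc]
  by_cases hr : r = 0
  · exact ⟨0, 1, by simp [hr]⟩
  obtain ⟨a, A, B, ha, ha0, hA0, hA, hB, h⟩ := hgen (Ideal.span {r}) (by simpa using hr)
  obtain ⟨ε, -, -, -, -, -, -, hε, -⟩ := exists_unit_mul_mem hTorsion hfin hPic hr ha ha0 hA0 hA hB h
  exact ⟨⟨r * ε, hε⟩, ε⁻¹, by simp⟩

end Atoms

/-! ### Comparison with the localization -/

section Localization

variable {R : Type u} [CommRing R] {O : Subring R}

theorem exists_associated_algebraMap (P : HeightOneSpectrum R) (ξ : LocalOrder O P) :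
    ∃ x : O, Associated ξ (algebraMap O (LocalOrder O P) x) := by
  obtain ⟨⟨x, s⟩, h⟩ := IsLocalization.surj (P.asIdeal.under O).primeCompl ξ
  exact ⟨x, h ▸ (associated_mul_unit_right _ _ (IsLocalization.map_units _ s))⟩

theorem isLocalAtom_of_irreducible (P : HeightOneSpectrum R) {x : O}
    (hx : Irreducible (algebraMap O (LocalOrder O P) x)) : IsLocalAtom O P (x : R) := by
  have hu : ∀ y : O, IsUnit (algebraMap O (LocalOrder O P) y) ↔ (y : R) ∉ P.asIdeal := fun y ↦
    IsLocalization.AtPrime.isUnit_to_map_iff _ (P.asIdeal.under O) y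
  refine ⟨not_not.1 ((hu x).not.1 hx.not_isUnit), fun y z s hy hz hs hsP h ↦ ?_⟩
  have hs' : IsUnit (algebraMap O (LocalOrder O P) ⟨s, hs⟩) := (hu ⟨s, hs⟩).2 hsP
  have hirr := (associated_mul_unit_right _ _ hs').irreducible hx
  rw [← map_mul] at hirr
  have h' : x * ⟨s, hs⟩ = (⟨y, hy⟩ * ⟨z, hz⟩ : O) := Subtype.ext h
  rw [h', map_mul] at hirr
  exact (hirr.isUnit_or_isUnit rfl).imp (hu ⟨y, hy⟩).1 (hu ⟨z, hz⟩).1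

variable [IsDedekindDomain R]

theorem localValuation_algebraMap (P : HeightOneSpectrum R) {x : O} (hx : x ≠ 0) :
    localValuation O P (algebraMap O (LocalOrder O P) x) = val P (x : R) := by
  obtain ⟨k, hk⟩ := exists_val_eq P (r := (x : R)) fun h ↦ hx (Subtype.ext h)
  obtain ⟨S, hS, hSP⟩ := val_eq_iff.1 hk
  have hmap : (Ideal.span {(x : R)}).map (algebraMap R (Localization.AtPrime P.asIdeal)) =
      IsLocalRing.maximalIdeal (Localization.AtPrime P.asIdeal) ^ k := by
    have hStop : S.map (algebraMap R (Localization.AtPrime P.asIdeal)) = ⊤ := by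
      obtain ⟨s, hsS, hsP⟩ := SetLike.not_le_iff_exists.1 hSP
      exact Ideal.eq_top_of_isUnit_mem _ (Ideal.mem_map_of_mem _ hsS)
        ((IsLocalization.AtPrime.isUnit_to_map_iff _ P.asIdeal s).2 hsP)
    rw [hS, Ideal.map_mul, Ideal.map_pow, hStop, Ideal.mul_top,
      Localization.AtPrime.map_eq_maximalIdeal]
  rw [localValuation, Localization.localRingHom_to_map, hk, ← Set.image_singleton,
    ← Ideal.map_span]
  change emultiplicity _ (Ideal.map _ (Ideal.span {(x : R)})) = _
  rw [hmap]
  refine emultiplicity_pow_self ?_ ?_ k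
  · rw [← Localization.AtPrime.map_eq_maximalIdeal]
    exact fun h ↦ P.ne_bot ((Ideal.map_eq_bot_iff_of_injective
      (IsLocalization.injective _ P.asIdeal.primeCompl_le_nonZeroDivisors)).1 h)
  · rw [Ideal.isUnit_iff]
    exact (IsLocalRing.maximalIdeal.isMaximal _).ne_top

theorem localValuation_eq_of_associated (P : HeightOneSpectrum R) {ξ η : LocalOrder O P}
    (h : Associated ξ η) : localValuation O P ξ = localValuation O P η := by
  rw [localValuation, localValuation, Ideal.span_singleton_eq_span_singleton.2]
  exact h.map _

theorem irreducible_of_val_eq_one (P : HeightOneSpectrum R) {x : O}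
    (hx : val P (x : R) = 1) : Irreducible (algebraMap O (LocalOrder O P) x) := by
  have hu : ∀ y : O, IsUnit (algebraMap O (LocalOrder O P) y) ↔ (y : R) ∉ P.asIdeal := fun y ↦
    IsLocalization.AtPrime.isUnit_to_map_iff _ (P.asIdeal.under O) y
  refine ⟨fun h ↦ (hu x).1 h (one_le_val_iff.1 hx.ge), fun η ζ h ↦ ?_⟩
  obtain ⟨⟨y, s⟩, hy⟩ := IsLocalization.surj (P.asIdeal.under O).primeCompl η
  obtain ⟨⟨z, t⟩, hz⟩ := IsLocalization.surj (P.asIdeal.under O).primeCompl ζ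
  have hs := IsLocalization.map_units (LocalOrder O P) s
  have ht := IsLocalization.map_units (LocalOrder O P) t
  have heq : x * (s * t) = y * z := by
    refine IsLocalization.injective (LocalOrder O P)
      (Ideal.primeCompl_le_nonZeroDivisors (P.asIdeal.under O)) ?_
    simp only [map_mul] at *
    rw [h, ← hy, ← hz, mul_mul_mul_comm]
  have hval := congrArg (val P) (congrArg Subtype.val heq)
  rw [Subring.coe_mul, Subring.coe_mul, Subring.coe_mul, val_mul, val_mul, val_mul,
    val_eq_zero_iff.2 ((hu _).1 hs), val_eq_zero_iff.2 ((hu _).1 ht), hx, add_zero, add_zero] at hval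
  have hη : IsUnit η ↔ (y : R) ∉ P.asIdeal := by
    rw [← hu, ← hy, IsUnit.mul_iff, and_iff_left hs]
  have hζ : IsUnit ζ ↔ (z : R) ∉ P.asIdeal := by
    rw [← hu, ← hz, IsUnit.mul_iff, and_iff_left ht]
  rw [hη, hζ]
  by_contra! hcon
  have h2 := add_le_add (one_le_val_iff.2 hcon.1) (one_le_val_iff.2 hcon.2)
  rw [← hval] at h2
  exact absurd h2 (by decide)

end Localization

end TransferKrull

theorem proposition4p2 {R : Type u} [CommRing R] [IsDedekindDomain R]
    (hTorsion : ∀ g : ClassGroup R, IsOfFinOrder g)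
    (O : Subring R) (hO : TransferKrull.IsOrderIn O)
    (hFinite : Finite (R ⧸ TransferKrull.orderConductor O))
    (hPrimes : ∀ g : ClassGroup R, ∃ Q : HeightOneSpectrum R,
      TransferKrull.primeClass Q = g ∧ IsCoprime Q.asIdeal (TransferKrull.orderConductor O))
    -- the canonical map `Pic(O) → Cl(R)`, `[I] ↦ [I R]`, is an isomorphism
    (hPic : Function.Bijective (ClassGroup.extendedHom O R))
    (hKrull : TransferKrull.IsTransferKrullDomain.{u, v} O) :
    (∀ P : HeightOneSpectrum R, P.asIdeal ∣ TransferKrull.orderConductor O →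
      -- `P` is the only prime over `𝔭 = P ∩ O`, so that `v_𝔭` is defined
      (∀ Q : HeightOneSpectrum R, Q.asIdeal.under O = P.asIdeal.under O → Q = P) ∧
      (orderOf (TransferKrull.primeClass P) = 2 → TransferKrull.atomValuations O P ⊆ {1, 2}) ∧
      (orderOf (TransferKrull.primeClass P) ≠ 2 → TransferKrull.atomValuations O P = {1})) ∧
    (∀ r : R, ∃ a : O, ∃ ε : Rˣ, r = a * ε) := by
  have := hO.finite
  have hint : Algebra.IsIntegral O R := Algebra.IsIntegral.of_finite O R
  have hf := TransferKrull.orderConductor_ne_bot hO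
  obtain ⟨c, hc, hc0⟩ := Submodule.exists_mem_ne_zero_of_ne_bot hf
  obtain ⟨B, _, Θ, hΘ⟩ := TransferKrull.exists_isTransferOn hKrull hc hc0
  have huniq : ∀ P Q : HeightOneSpectrum R, Q.asIdeal.under O = P.asIdeal.under O → Q = P :=
    fun P Q h ↦ hΘ.eq_of_under_eq hf hFinite hTorsion h
  have hval := fun (P : HeightOneSpectrum R) (hP : P.asIdeal ∣ TransferKrull.orderConductor O)
    (x : R) (hxO : x ∈ O) (hx0 : x ≠ 0) (hx : TransferKrull.IsLocalAtom O P x) ↦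
    hx.val_eq hTorsion hf hFinite hPrimes hPic.1 huniq hΘ hP hxO hx0
  have hone := fun (P : HeightOneSpectrum R)
    (hP : P.asIdeal ∣ TransferKrull.orderConductor O) ↦
    TransferKrull.exists_val_eq_one hf
      fun x hxO hx0 hx ↦ (hval P hP x hxO hx0 hx).imp_right And.left
  have hatoms : ∀ P : HeightOneSpectrum R, P.asIdeal ∣ TransferKrull.orderConductor O →
      ∀ n ∈ TransferKrull.atomValuations O P,
        n = 1 ∨ n = 2 ∧ orderOf (TransferKrull.primeClass P) = 2 := by
    rintro P hP _ ⟨ξ, hξ, rfl⟩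
    obtain ⟨x, hx⟩ := TransferKrull.exists_associated_algebraMap P ξ
    have hirr := hx.irreducible hξ
    have hx0 : x ≠ 0 := by
      rintro rfl
      exact hirr.ne_zero (map_zero _)
    rw [TransferKrull.localValuation_eq_of_associated P hx,
      TransferKrull.localValuation_algebraMap P hx0]
    exact hval P hP x x.2 (fun h ↦ hx0 (Subtype.ext h))
      (TransferKrull.isLocalAtom_of_irreducible P hirr)
  refine ⟨fun P hP ↦ ⟨huniq P, fun _ n hn ↦ (hatoms P hP n hn).imp_right And.left, fun hne ↦ ?_⟩,
    TransferKrull.exists_eq_mul_unit hTorsion hf hFinite hPic.1 huniq hone⟩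
  refine Set.Subset.antisymm (fun n hn ↦ (hatoms P hP n hn).resolve_right fun h ↦ hne h.2) ?_
  rintro _ rfl
  obtain ⟨x, hxO, hx0, hx⟩ := hone P hP
  have hx0' : (⟨x, hxO⟩ : O) ≠ 0 := fun h ↦ hx0 (congrArg Subtype.val h)
  exact ⟨_, TransferKrull.irreducible_of_val_eq_one (x := ⟨x, hxO⟩) P hx,
    (TransferKrull.localValuation_algebraMap P hx0').trans hx⟩
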